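/- **Conventions.** All lattices have a least element $0$ and a greatest element $1$ ($0=1$ is allowed), and lattice homomorphisms preserve $0$ and $1$. For a bitopological space $(S,\mathcal T^+,\mathcal T^-)$ let $\mathcal L^+$ be the family of all $U\in\mathcal T^+$ with $S\setminus U\in\mathcal T^-$, and $\mathcal L^-$ the family of all $U\in\mathcal T^-$ with $S\setminus U\in\mathcal T^+$. The space (possibly empty) is an *abstract spectrum* if $\mathcal L^{+}$ is a base of $\mathcal T^{+}$ and $\mathcal L^-$ is a base of $\mathcal T^-$, every $\mathcal T^+$-closed set is $\mathcal T^-$-compact and every $\mathcal T^-$-closed set is $\mathcal T^+$-compact, and at least one of $\mathcal T^+,\mathcal T^-$ is $T_0$. An $\mathbf S$-*morphism* is a map between abstract spectra that is continuous for the topologies $\mathcal T^+$ and for the topologies $\mathcal T^-$; an $\mathbf S$-*isomorphism* is a bijective $\mathbf S$-morphism whose inverse is an $\mathbf S$-morphism. Any family $S$ of subsets of a set $X$ carries the topology $\mathcal T^+$ with subbase $\{p\in S: x\notin p\}$, $x\in X$, and the topology $\mathcal T^-$ with subbase $\{p\in S: x\in p\}$, $x\in X$. For a distributive lattice $L$,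 $\operatorname{spec}(L)$ is the set of (proper) prime ideals of $L$ with these two topologies ($\mathcal T^+$ is the Stone topology). **Statement.** Let $X$ be a set with two arbitrary multivalued binary operations $\oplus,\otimes$ (maps $X\times X\to\{\text{subsets of }X\}$) and two fixed different points $\xi_0,\xi_1\in X$. A subset $p\subseteq X$ is a *prime ideal* of $(X,\oplus,\otimes)$ if $x,y\in p$ implies $x\oplus y\subseteq p$, and $(x\otimes y)\cap p\ne\emptyset$ implies $x\in p$ or $y\in p$; it is *proper* if moreover $\xi_0\in p$ and $\xi_1\notin p$. Let $S$ be either the family $S(X)_{pr}$ of all proper prime ideals or the family $S(X)$ of all prime ideals. Then there exist a distributive lattice $L$ and a function $\varphi:X\to L$ such that: (i) $\varphi(X)$ generates $L$ (as a lattice with $0$ and $1$); (ii) $\varphi^{-1}(q)\in S$ for every $q\in\operatorname{spec}(L)$; (iii) $\Phi:\operatorname{spec}(L)\to S$, $q\mapsto\varphi^{-1}(q)$, is an $\mathbf S$-isomorphism; (iv) if $L'$ is a distributive lattice and $\theta:X\to L'$ is a function such that $\theta^{-1}(q)\in S$ for every $q\in\operatorname{spec}(L')$ and $\operatorname{spec}(L')\to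 S$, $q\mapsto\theta^{-1}(q)$, is an $\mathbf S$-morphism, then there is a unique lattice homomorphism $l:L\to L'$ with $l\circ\varphi=\theta$; (v) if $L_1$ is a distributive lattice and $\varphi_1:X\to L_1$ is a function such that $\varphi_1^{-1}(q)\in S$ for every $q\in\operatorname{spec}(L_1)$ and $\operatorname{spec}(L_1)\to S$, $q\mapsto\varphi_1^{-1}(q)$, is an $\mathbf S$-isomorphism, then there is a unique lattice isomorphism $l:L\to L_1$ with $l\circ\varphi=\varphi_1$; (vi) $a\oplus b\subseteq\{x\in X:\varphi(x)\le\varphi(a)\vee\varphi(b)\}$ and $a\otimes b\subseteq\{x\in X:\varphi(x)\ge\varphi(a)\wedge\varphi(b)\}$ for all $a,b\in X$. -/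

import Mathlib

universe u v

/-- A bitopological space: a set with two topologies `𝒯⁺` and `𝒯⁻`. -/
structure BitopologicalSpace (S : Type*) where
  /-- the topology `𝒯⁺` -/
  plus : TopologicalSpace S
  /-- the topology `𝒯⁻` -/
  minus : TopologicalSpace S

namespace BitopologicalSpace

/-- `ℒ⁺`: the `𝒯⁺`-open sets whose complement is `𝒯⁻`-open. -/
def latticePlus {S : Type*} (B : BitopologicalSpace S) : Set (Set S) :=
  {U | @IsOpen S B.plus U ∧ @IsOpen S B.minus Uᶜ}

/-- `ℒ⁻`: the `𝒯⁻`-open sets whose complement is `𝒯⁺`-open. -/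
def latticeMinus {S : Type*} (B : BitopologicalSpace S) : Set (Set S) :=
  {U | @IsOpen S B.minus U ∧ @IsOpen S B.plus Uᶜ}

/-- Abstract spectra. The empty bitopological space is admitted: it is the spectrum of the
one-element lattice, and it is the space of proper prime ideals when there are none. -/
structure IsAbstractSpectrum {S : Type*} (B : BitopologicalSpace S) : Prop where
  /-- (SP1) for `𝒯⁺` -/
  basis_plus : @TopologicalSpace.IsTopologicalBasis S B.plus B.latticePlus
  /-- (SP1) for `𝒯⁻` -/
  basis_minus : @TopologicalSpace.IsTopologicalBasis S B.minus B.latticeMinus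
  /-- (SP2): `𝒯⁺`-closed sets are `𝒯⁻`-compact -/
  compact_minus : ∀ F : Set S, @IsOpen S B.plus Fᶜ → @IsCompact S B.minus F
  /-- (SP2): `𝒯⁻`-closed sets are `𝒯⁺`-compact -/
  compact_plus : ∀ F : Set S, @IsOpen S B.minus Fᶜ → @IsCompact S B.plus F
  /-- (SP3) -/
  t0 : @T0Space S B.plus ∨ @T0Space S B.minus

/-- A morphism of abstract spectra: a map between abstract spectra which is continuous for the
topologies `𝒯⁺` and for the topologies `𝒯⁻`. -/
structure IsSMorphism {S T : Type*} (B : BitopologicalSpace S) (C : BitopologicalSpace T)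
    (f : S → T) : Prop where
  source : B.IsAbstractSpectrum
  target : C.IsAbstractSpectrum
  continuous_plus : @Continuous S T B.plus C.plus f
  continuous_minus : @Continuous S T B.minus C.minus f

/-- An isomorphism in the category of abstract spectra. -/
def IsSIsomorphism {S T : Type*} (B : BitopologicalSpace S) (C : BitopologicalSpace T)
    (f : S → T) : Prop :=
  IsSMorphism B C f ∧
    ∃ g : T → S, IsSMorphism C B g ∧ Function.LeftInverse g f ∧ Function.RightInverse g f

end BitopologicalSpace

/-- The two topologies on a family `S` of subsets of `X`: the sets `{p ∈ S | x ∉ p}`, `x ∈ X`, are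
a subbase of `𝒯⁺`, and the sets `{p ∈ S | x ∈ p}`, `x ∈ X`, are a subbase of `𝒯⁻`. -/
def familyBitopology {X : Type*} (S : Set (Set X)) : BitopologicalSpace S where
  plus := TopologicalSpace.generateFrom (Set.range fun x : X => {p : S | x ∉ (p : Set X)})
  minus := TopologicalSpace.generateFrom (Set.range fun x : X => {p : S | x ∈ (p : Set X)})

/-- `p` is a prime ideal in `(X, ⊕, ⊗)`, for multivalued operations `⊕` and `⊗`. -/
structure IsMultiPrimeIdeal {X : Type*} (oplus otimes : X → X → Set X) (p : Set X) : Prop where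
  oplus_subset : ∀ x y, x ∈ p → y ∈ p → oplus x y ⊆ p
  mem_or_mem : ∀ x y, (otimes x y ∩ p).Nonempty → x ∈ p ∨ y ∈ p

/-- `S(X)`: the set of all prime ideals in `(X, ⊕, ⊗)`. -/
def primeIdeals {X : Type*} (oplus otimes : X → X → Set X) : Set (Set X) :=
  {p | IsMultiPrimeIdeal oplus otimes p}

/-- `S(X)_pr`: the set of all prime ideals in `(X, ⊕, ⊗)` that are proper with respect to the
points `ξ₀` and `ξ₁`. -/
def properPrimeIdeals {X : Type*} (oplus otimes : X → X → Set X) (ξ₀ ξ₁ : X) : Set (Set X) :=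
  {p | IsMultiPrimeIdeal oplus otimes p ∧ ξ₀ ∈ p ∧ ξ₁ ∉ p}

/-- `spec(L)`: the set of all (proper) prime ideals of the lattice `L`. It carries the topologies
of `familyBitopology`, of which `𝒯⁺` is the Stone topology. -/
def latticeSpec (L : Type*) [DistribLattice L] : Set (Set L) :=
  {q | ∃ I : Order.Ideal L, I.IsPrime ∧ (I : Set L) = q}

/-- For `φ : X → L` such that `φ⁻¹(q) ∈ S` for every `q ∈ spec(L)`, the map `spec(L) → S`,
`q ↦ φ⁻¹(q)`. -/
def specPreimage {X L : Type*} [DistribLattice L] (S : Set (Set X)) (φ : X → L)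
    (h : ∀ q ∈ latticeSpec L, φ ⁻¹' q ∈ S) : latticeSpec L → S :=
  fun q => ⟨φ ⁻¹' (q : Set L), h q q.2⟩

/-- The subset `A` generates `L` as a lattice with `0` and `1`. -/
def GeneratesLattice {L : Type*} [DistribLattice L] [BoundedOrder L] (A : Set L) : Prop :=
  ∀ M : Sublattice L, ⊥ ∈ M → ⊤ ∈ M → A ⊆ M → ∀ a : L, a ∈ M

/-!
The lattice `L` is the lattice `ℒ⁺` of the bitopological space `S`, with
`φ x = {p ∈ S | x ∉ p}`, and everything is Stone duality. The ultralimit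
`{x | x ∈ p for 𝓕-almost all p}` of an ultrafilter `𝓕` on `S` is, when it belongs to `S`, a limit
of `𝓕` in both topologies; since the conditions defining prime ideals are preserved by ultralimits,
this gives the compactness axiom (SP2). That axiom makes each member of `ℒ⁺` a `𝒯⁺`-compact open
set, so that `ℒ⁺` is generated by the subbase of `𝒯⁺`, and each prime ideal of `ℒ⁺` the ideal of
all members of `ℒ⁺` avoiding some point of `S`. Hence `spec(ℒ⁺) ≅ S` and `L' ≅ ℒ⁺(spec L')`, and a
morphism `spec(L') → S` is dual to a homomorphism `ℒ⁺(S) → ℒ⁺(spec L') ≅ L'`.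
-/

open Set Function TopologicalSpace
open scoped Topology

section GenerateFrom

variable {T : Type*}

lemma isTopologicalBasis_isOpen_and_isOpen_compl {t' t : TopologicalSpace T} {s : Set (Set T)}
    (ht : t = generateFrom s) (hs : ∀ U ∈ s, IsOpen[t'] Uᶜ) :
    @IsTopologicalBasis T t {U | IsOpen[t] U ∧ IsOpen[t'] Uᶜ} := by
  have hbasis := isTopologicalBasis_of_subbasis ht
  refine hbasis.of_isOpen_of_subset (fun U hU => hU.1) fun U hU => ⟨hbasis.isOpen hU, ?_⟩
  obtain ⟨f, ⟨-, hfs⟩, rfl⟩ := hU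
  rw [compl_sInter]
  exact @isOpen_sUnion T t' _ (forall_mem_image.mpr fun V hV => hs V (hfs hV))

lemma mem_sublattice_of_isCompact_of_isOpen [t : TopologicalSpace T] {s : Set (Set T)}
    (ht : t = generateFrom s) {M : Sublattice (Set T)} (hbot : ⊥ ∈ M) (htop : ⊤ ∈ M)
    (hs : s ⊆ M) {U : Set T} (hUc : IsCompact U) (hUo : IsOpen U) : U ∈ M := by
  obtain ⟨F, rfl⟩ := eq_sUnion_finset_of_isTopologicalBasis_of_isCompact_open _
    (isTopologicalBasis_of_subbasis ht) U hUc hUo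
  refine M.supClosed.sSup_mem (F.finite_toSet.image _) hbot ?_
  rintro _ ⟨⟨_, f, ⟨hf, hfs⟩, rfl⟩, -, rfl⟩
  exact M.infClosed.sInf_mem hf htop (hfs.trans hs)

end GenerateFrom

section FamilyBitopology

variable {X : Type*} {S : Set (Set X)}

/-- The ultralimit of an ultrafilter on a family `S` of subsets of `X`: if it belongs to `S`, it is
a limit of the ultrafilter in both topologies. -/
def ultralimit (𝓕 : Ultrafilter S) : Set X :=
  {x | ∀ᶠ p : S in 𝓕, x ∈ p.1}

lemma notMem_ultralimit {𝓕 : Ultrafilter S} {x : X} :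
    x ∉ ultralimit 𝓕 ↔ ∀ᶠ p : S in 𝓕, x ∉ p.1 :=
  Ultrafilter.eventually_not.symm

variable (S) in
lemma isOpen_plus_notMem (x : X) :
    IsOpen[(familyBitopology S).plus] {p : S | x ∉ (p : Set X)} :=
  isOpen_generateFrom_of_mem ⟨x, rfl⟩

variable (S) in
lemma isOpen_minus_mem (x : X) : IsOpen[(familyBitopology S).minus] {p : S | x ∈ (p : Set X)} :=
  isOpen_generateFrom_of_mem ⟨x, rfl⟩

variable (S) in
lemma isOpen_minus_compl_notMem (x : X) :
    IsOpen[(familyBitopology S).minus] {p : S | x ∉ (p : Set X)}ᶜ := by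
  simpa only [compl_ofPred, not_not] using isOpen_minus_mem S x

lemma le_nhds_plus_ultralimit {𝓕 : Ultrafilter S} (h : ultralimit 𝓕 ∈ S) :
    (𝓕 : Filter S) ≤ @nhds S (familyBitopology S).plus ⟨ultralimit 𝓕, h⟩ := by
  refine (tendsto_nhds_generateFrom_iff (m := id)).mpr ?_
  rintro _ ⟨x, rfl⟩ hx
  exact notMem_ultralimit.mp hx

lemma le_nhds_minus_ultralimit {𝓕 : Ultrafilter S} (h : ultralimit 𝓕 ∈ S) :
    (𝓕 : Filter S) ≤ @nhds S (familyBitopology S).minus ⟨ultralimit 𝓕, h⟩ := by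
  refine (tendsto_nhds_generateFrom_iff (m := id)).mpr ?_
  rintro _ ⟨x, rfl⟩ hx
  exact hx

variable (S) in
lemma t0Space_familyBitopology_plus : @T0Space S (familyBitopology S).plus := by
  refine @T0Space.mk S (familyBitopology S).plus fun p q hpq => ?_
  ext x
  exact not_iff_not.mp <|
    (@inseparable_iff_forall_isOpen S (familyBitopology S).plus p q).mp hpq _
      (isOpen_plus_notMem S x)

theorem isAbstractSpectrum_familyBitopology (hS : ∀ 𝓕 : Ultrafilter S, ultralimit 𝓕 ∈ S) :
    (familyBitopology S).IsAbstractSpectrum where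
  basis_plus :=
    isTopologicalBasis_isOpen_and_isOpen_compl rfl
      (forall_mem_range.mpr (isOpen_minus_compl_notMem S))
  basis_minus :=
    isTopologicalBasis_isOpen_and_isOpen_compl rfl (forall_mem_range.mpr (isOpen_plus_notMem S))
  compact_minus F hF := by
    refine (@isCompact_iff_ultrafilter_le_nhds' S (familyBitopology S).minus F).mpr fun 𝓕 h𝓕 =>
      ⟨⟨ultralimit 𝓕, hS 𝓕⟩, ?_, le_nhds_minus_ultralimit (hS 𝓕)⟩
    exact (@isClosed_iff_ultrafilter S F (familyBitopology S).plus).mp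
      (@IsClosed.mk S (familyBitopology S).plus F hF) _ 𝓕 (le_nhds_plus_ultralimit (hS 𝓕)) h𝓕
  compact_plus F hF := by
    refine (@isCompact_iff_ultrafilter_le_nhds' S (familyBitopology S).plus F).mpr fun 𝓕 h𝓕 =>
      ⟨⟨ultralimit 𝓕, hS 𝓕⟩, ?_, le_nhds_plus_ultralimit (hS 𝓕)⟩
    exact (@isClosed_iff_ultrafilter S F (familyBitopology S).minus).mp
      (@IsClosed.mk S (familyBitopology S).minus F hF) _ 𝓕 (le_nhds_minus_ultralimit (hS 𝓕)) h𝓕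
  t0 := .inl (t0Space_familyBitopology_plus S)

end FamilyBitopology

section MultiPrimeIdeal

variable {X : Type*} (oplus otimes : X → X → Set X)

variable {oplus otimes} in
lemma isMultiPrimeIdeal_ultralimit {S : Set (Set X)} (hS : S ⊆ primeIdeals oplus otimes)
    (𝓕 : Ultrafilter S) : IsMultiPrimeIdeal oplus otimes (ultralimit 𝓕) where
  oplus_subset x y hx hy z hz := by
    filter_upwards [hx, hy] with p hxp hyp
    exact (hS p.2).oplus_subset x y hxp hyp hz
  mem_or_mem := by
    rintro x y ⟨z, hz, hz𝓕⟩
    refine Ultrafilter.eventually_or.mp ?_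
    filter_upwards [hz𝓕] with p hzp
    exact (hS p.2).mem_or_mem x y ⟨z, hz, hzp⟩

theorem isAbstractSpectrum_primeIdeals :
    (familyBitopology (primeIdeals oplus otimes)).IsAbstractSpectrum :=
  isAbstractSpectrum_familyBitopology (isMultiPrimeIdeal_ultralimit subset_rfl)

theorem isAbstractSpectrum_properPrimeIdeals (ξ₀ ξ₁ : X) :
    (familyBitopology (properPrimeIdeals oplus otimes ξ₀ ξ₁)).IsAbstractSpectrum :=
  isAbstractSpectrum_familyBitopology fun 𝓕 =>
    ⟨isMultiPrimeIdeal_ultralimit (fun _ hp => hp.1) 𝓕, .of_forall fun p => p.2.2.1,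
      notMem_ultralimit.mpr (.of_forall fun p => p.2.2.2)⟩

end MultiPrimeIdeal

section LatticeSpec

variable {L : Type*} [DistribLattice L]

variable (L) in
lemma latticeSpec_eq_properPrimeIdeals [BoundedOrder L] :
    latticeSpec L =
      properPrimeIdeals (fun a b : L => Iic (a ⊔ b)) (fun a b => Ici (a ⊓ b)) ⊥ ⊤ := by
  ext q
  constructor
  · rintro ⟨I, hI, rfl⟩
    refine ⟨⟨fun a b ha hb c hc => I.lower hc (I.sup_mem ha hb), ?_⟩, I.bot_mem,
      hI.toIsProper.top_notMem⟩
    rintro a b ⟨c, hc, hcI⟩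
    exact hI.mem_or_mem (I.lower hc hcI)
  · rintro ⟨⟨hsup, hinf⟩, hbot, htop⟩
    let I : Order.Ideal L :=
      { carrier := q
        lower' := fun a b hba ha => hsup a a ha ha (le_sup_of_le_left hba)
        nonempty' := ⟨⊥, hbot⟩
        directed' := fun a ha b hb =>
          ⟨a ⊔ b, hsup a b ha hb self_mem_Iic, le_sup_left, le_sup_right⟩ }
    have : I.IsProper := Order.Ideal.isProper_of_notMem (p := ⊤) htop
    exact ⟨I, .of_mem_or_mem fun {a b} hab => hinf a b ⟨a ⊓ b, self_mem_Ici, hab⟩, rfl⟩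

variable (L) in
theorem isAbstractSpectrum_latticeSpec [BoundedOrder L] :
    (familyBitopology (latticeSpec L)).IsAbstractSpectrum := by
  rw [latticeSpec_eq_properPrimeIdeals]
  exact isAbstractSpectrum_properPrimeIdeals _ _ _ _

namespace latticeSpec

variable (q : latticeSpec L) {a b : L}

lemma sup_mem_iff : a ⊔ b ∈ q.1 ↔ a ∈ q.1 ∧ b ∈ q.1 := by
  obtain ⟨_, I, -, rfl⟩ := q
  exact Order.Ideal.sup_mem_iff

lemma inf_mem_iff : a ⊓ b ∈ q.1 ↔ a ∈ q.1 ∨ b ∈ q.1 := by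
  obtain ⟨_, I, hI, rfl⟩ := q
  exact ⟨hI.mem_or_mem, fun h => h.elim (I.lower inf_le_left) (I.lower inf_le_right)⟩

lemma bot_mem [OrderBot L] : ⊥ ∈ q.1 := by
  obtain ⟨_, I, -, rfl⟩ := q
  exact I.bot_mem

lemma top_notMem [OrderTop L] : ⊤ ∉ q.1 := by
  obtain ⟨_, I, hI, rfl⟩ := q
  exact hI.toIsProper.top_notMem

variable {q} in
lemma mem_of_le (hab : a ≤ b) : b ∈ q.1 → a ∈ q.1 := by
  obtain ⟨_, I, -, rfl⟩ := q
  exact fun hb => I.lower hab hb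

lemma exists_mem_notMem_of_not_le (hab : ¬a ≤ b) : ∃ q : latticeSpec L, b ∈ q.1 ∧ a ∉ q.1 := by
  have hdisj : Disjoint (Order.PFilter.principal a : Set L) (Order.Ideal.principal b) :=
    Set.disjoint_left.mpr fun c hac hcb =>
      hab ((Order.PFilter.mem_principal.mp hac).trans (Order.Ideal.mem_principal.mp hcb))
  obtain ⟨J, hJ, hbJ, haJ⟩ := DistribLattice.prime_ideal_of_disjoint_filter_ideal hdisj
  exact ⟨⟨J, J, hJ, rfl⟩, hbJ (Order.Ideal.mem_principal.mpr le_rfl),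
    Set.disjoint_left.mp haJ (Order.PFilter.mem_principal.mpr le_rfl)⟩

end latticeSpec

end LatticeSpec

lemma GeneratesLattice.eq_of_comp_eq {X L L' F : Type*} [DistribLattice L] [BoundedOrder L]
    [Lattice L'] [BoundedOrder L'] [FunLike F L L'] [BoundedLatticeHomClass F L L'] {φ : X → L}
    (hφ : GeneratesLattice (range φ)) {f g : F} (h : f ∘ φ = g ∘ φ) : f = g := by
  let eqLocus : Sublattice L :=
    { carrier := {a | f a = g a}
      supClosed' := fun a (ha : f a = g a) b (hb : f b = g b) => by
        rw [mem_ofPred_eq, map_sup, map_sup, ha, hb]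
      infClosed' := fun a (ha : f a = g a) b (hb : f b = g b) => by
        rw [mem_ofPred_eq, map_inf, map_inf, ha, hb] }
  exact DFunLike.ext f g <|
    hφ eqLocus ((map_bot f).trans (map_bot g).symm) ((map_top f).trans (map_top g).symm)
      (range_subset_iff.mpr (congrFun h))

namespace BitopologicalSpace

section SublatticePlus

variable {T : Type*} (B : BitopologicalSpace T)

/-- `ℒ⁺` as a lattice of sets: the distributive lattice dual to an abstract spectrum. -/
def sublatticePlus : Sublattice (Set T) where
  carrier := B.latticePlus
  supClosed' U hU V hV := by
    refine ⟨@IsOpen.union T U V B.plus hU.1 hV.1, ?_⟩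
    rw [compl_sup]
    exact @IsOpen.inter T B.minus Uᶜ Vᶜ hU.2 hV.2
  infClosed' U hU V hV := by
    refine ⟨@IsOpen.inter T B.plus U V hU.1 hV.1, ?_⟩
    rw [compl_inf]
    exact @IsOpen.union T Uᶜ Vᶜ B.minus hU.2 hV.2

instance : BoundedOrder B.sublatticePlus :=
  Subtype.boundedOrder
    ⟨@isOpen_empty T B.plus, by rw [bot_eq_empty, compl_empty]; exact @isOpen_univ T B.minus⟩
    ⟨@isOpen_univ T B.plus, by rw [top_eq_univ, compl_univ]; exact @isOpen_empty T B.minus⟩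

/-- The prime ideal of `ℒ⁺` corresponding to the point `p` of an abstract spectrum. -/
def pointIdeal (p : T) : latticeSpec B.sublatticePlus :=
  ⟨{U | p ∉ U.1}, by
    rw [latticeSpec_eq_properPrimeIdeals]
    refine ⟨⟨fun U V hU hV W hW hp => (hW hp).elim hU hV, ?_⟩, id, not_not.mpr trivial⟩
    rintro U V ⟨W, hW, hp⟩
    exact not_and_or.mp fun hUV => hp (hW hUV)⟩

variable {B}

lemma IsAbstractSpectrum.exists_mem_forall_notMem (hB : B.IsAbstractSpectrum)
    {q : latticeSpec B.sublatticePlus} {V : B.sublatticePlus} (hV : V ∉ q.1) :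
    ∃ p ∈ V.1, ∀ U ∈ q.1, p ∉ U.1 := by
  let := B.plus
  by_contra! hcover
  have : Nonempty q.1 := ⟨⊥, latticeSpec.bot_mem q⟩
  obtain ⟨U, hVU⟩ := (hB.compact_plus V V.2.2).elim_directed_cover (fun U : q.1 => U.1.1)
    (fun U => U.1.2.1) (fun p hp => by simpa using hcover p hp)
    fun U U' => ⟨⟨U ⊔ U', (latticeSpec.sup_mem_iff q).mpr ⟨U.2, U'.2⟩⟩,
      subset_union_left, subset_union_right⟩
  exact hV (latticeSpec.mem_of_le hVU U.2)

theorem IsAbstractSpectrum.pointIdeal_surjective (hB : B.IsAbstractSpectrum) :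
    Surjective B.pointIdeal := by
  intro q
  let := B.minus
  let Z : Set T := (⋃ U : q.1, U.1.1)ᶜ
  have hZ : IsCompact Z := hB.compact_minus Z <| by
    rw [compl_compl]
    exact @isOpen_iUnion T _ B.plus _ fun U : q.1 => U.1.2.1
  have : Nonempty {V // V ∉ q.1} := ⟨⊤, latticeSpec.top_notMem q⟩
  have hne : (Z ∩ ⋂ V : {V // V ∉ q.1}, V.1.1).Nonempty := by
    by_contra! hempty
    obtain ⟨V, hV⟩ := hZ.elim_directed_family_closed _ (fun V => ⟨V.1.2.2⟩) hempty
      fun V V' => ⟨⟨V ⊓ V', mt (latticeSpec.inf_mem_iff q).mp (not_or.mpr ⟨V.2, V'.2⟩)⟩,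
        inter_subset_left, inter_subset_right⟩
    obtain ⟨p, hpV, hp⟩ := hB.exists_mem_forall_notMem V.2
    exact hV.subset ⟨by simpa [Z] using hp, hpV⟩
  obtain ⟨p, hpZ, hpV⟩ := hne
  refine ⟨p, Subtype.ext (Set.ext fun U => ⟨fun hpU => ?_, fun hU hpU => ?_⟩)⟩
  · by_contra hU
    exact hpU (mem_iInter.mp hpV ⟨U, hU⟩)
  · exact hpZ (mem_iUnion.mpr ⟨⟨U, hU⟩, hpU⟩)

end SublatticePlus

section Functoriality

variable {T T' : Type*} {B : BitopologicalSpace T} {C : BitopologicalSpace T'} {f : T → T'}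

/-- The homomorphism `ℒ⁺(T') → ℒ⁺(T)` dual to a morphism `T → T'` of abstract spectra. -/
def IsSMorphism.preimageHom (hf : IsSMorphism B C f) :
    BoundedLatticeHom C.sublatticePlus B.sublatticePlus where
  toFun U := ⟨f ⁻¹' U, @IsOpen.preimage T T' B.plus C.plus f hf.continuous_plus U U.2.1,
    @IsOpen.preimage T T' B.minus C.minus f hf.continuous_minus _ U.2.2⟩
  map_sup' _ _ := rfl
  map_inf' _ _ := rfl
  map_top' := rfl
  map_bot' := rfl

lemma IsSIsomorphism.preimageHom_bijective (hf : IsSIsomorphism B C f) :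
    Bijective hf.1.preimageHom := by
  obtain ⟨hf, g, hg, hgf, hfg⟩ := hf
  refine bijective_iff_has_inverse.mpr ⟨hg.preimageHom, fun U => Subtype.ext ?_,
    fun U => Subtype.ext ?_⟩
  · exact hfg.preimage_preimage U
  · exact hgf.preimage_preimage U

end Functoriality

theorem isSMorphism_specPreimage {X L : Type*} [DistribLattice L] [BoundedOrder L]
    {S : Set (Set X)} (hS : (familyBitopology S).IsAbstractSpectrum) {θ : X → L}
    (hθ : ∀ q ∈ latticeSpec L, θ ⁻¹' q ∈ S) :
    IsSMorphism (familyBitopology (latticeSpec L)) (familyBitopology S) (specPreimage S θ hθ) where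
  source := isAbstractSpectrum_latticeSpec L
  target := hS
  continuous_plus := continuous_generateFrom_iff.mpr <|
    forall_mem_range.mpr fun x => isOpen_plus_notMem (latticeSpec L) (θ x)
  continuous_minus := continuous_generateFrom_iff.mpr <|
    forall_mem_range.mpr fun x => isOpen_minus_mem (latticeSpec L) (θ x)

theorem IsAbstractSpectrum.isSMorphism_pointIdeal {T : Type*} {B : BitopologicalSpace T}
    (hB : B.IsAbstractSpectrum) :
    IsSMorphism B (familyBitopology (latticeSpec B.sublatticePlus)) B.pointIdeal where
  source := hB
  target := isAbstractSpectrum_latticeSpec B.sublatticePlus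
  continuous_plus := continuous_generateFrom_iff.mpr <| forall_mem_range.mpr fun U => by
    convert U.2.1 using 1
    exact Set.ext fun _ => not_not
  continuous_minus := continuous_generateFrom_iff.mpr <| forall_mem_range.mpr fun U => U.2.2

end BitopologicalSpace

open BitopologicalSpace

section BasicOpen

variable {X : Type*} (S : Set (Set X))

/-- The canonical map `φ : X → ℒ⁺` for a family `S` of subsets of `X`. -/
def basicOpen (x : X) : (familyBitopology S).sublatticePlus :=
  ⟨{p | x ∉ p.1}, isOpen_plus_notMem S x, isOpen_minus_compl_notMem S x⟩

variable {S}

lemma basicOpen_le_sup_iff {a b x : X} :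
    basicOpen S x ≤ basicOpen S a ⊔ basicOpen S b ↔ ∀ p ∈ S, a ∈ p → b ∈ p → x ∈ p := by
  constructor
  · intro h p hp ha hb
    by_contra hx
    exact (@h ⟨p, hp⟩ hx).elim (· ha) (· hb)
  · intro h p hx
    exact not_and_or.mp fun hab => hx (h p p.2 hab.1 hab.2)

lemma inf_le_basicOpen_iff {a b x : X} :
    basicOpen S a ⊓ basicOpen S b ≤ basicOpen S x ↔ ∀ p ∈ S, x ∈ p → a ∈ p ∨ b ∈ p := by
  constructor
  · intro h p hp hx
    by_contra! hab
    exact @h ⟨p, hp⟩ hab hx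
  · rintro h p ⟨ha, hb⟩ hx
    exact (h p p.2 hx).elim ha hb

theorem generatesLattice_range_basicOpen (hS : (familyBitopology S).IsAbstractSpectrum) :
    GeneratesLattice (range (basicOpen S)) := by
  rintro M hbot htop hM ⟨U, hU⟩
  let := (familyBitopology S).plus
  have hUM : U ∈ M.map (familyBitopology S).sublatticePlus.subtype :=
    mem_sublattice_of_isCompact_of_isOpen
      (M := M.map (familyBitopology S).sublatticePlus.subtype) rfl ⟨⊥, hbot, rfl⟩ ⟨⊤, htop, rfl⟩
      (range_subset_iff.mpr fun x => ⟨basicOpen S x, hM ⟨x, rfl⟩, rfl⟩)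
      (hS.compact_plus U hU.2) hU.1
  exact (Sublattice.apply_mem_map_iff (Sublattice.subtype_injective _)).mp hUM

lemma preimage_basicOpen_pointIdeal (p : S) :
    basicOpen S ⁻¹' ((familyBitopology S).pointIdeal p).1 = p.1 :=
  Set.ext fun _ => not_not

lemma preimage_basicOpen_mem (hS : (familyBitopology S).IsAbstractSpectrum) :
    ∀ q ∈ latticeSpec (familyBitopology S).sublatticePlus, basicOpen S ⁻¹' q ∈ S := by
  intro q hq
  obtain ⟨p, hp⟩ := hS.pointIdeal_surjective ⟨q, hq⟩
  have hpq : basicOpen S ⁻¹' q = p.1 := by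
    rw [← preimage_basicOpen_pointIdeal, hp]
  exact hpq ▸ p.2

theorem isSIsomorphism_specPreimage_basicOpen (hS : (familyBitopology S).IsAbstractSpectrum) :
    IsSIsomorphism (familyBitopology (latticeSpec (familyBitopology S).sublatticePlus))
      (familyBitopology S) (specPreimage S (basicOpen S) (preimage_basicOpen_mem hS)) := by
  have hright : RightInverse (familyBitopology S).pointIdeal
      (specPreimage S (basicOpen S) (preimage_basicOpen_mem hS)) :=
    fun p => Subtype.ext (preimage_basicOpen_pointIdeal p)
  exact ⟨isSMorphism_specPreimage hS _, _, hS.isSMorphism_pointIdeal,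
    hright.rightInverse_of_surjective hS.pointIdeal_surjective, hright⟩

end BasicOpen

section Stone

variable (L : Type*) [DistribLattice L] [BoundedOrder L]

/-- The Stone representation of a distributive lattice by subsets of its spectrum. -/
def stoneHom : BoundedLatticeHom L (familyBitopology (latticeSpec L)).sublatticePlus where
  toFun := basicOpen (latticeSpec L)
  map_sup' _ _ := Subtype.ext <| Set.ext fun q =>
    (not_congr (latticeSpec.sup_mem_iff q)).trans not_and_or
  map_inf' _ _ := Subtype.ext <| Set.ext fun q =>
    (not_congr (latticeSpec.inf_mem_iff q)).trans not_or
  map_top' := Subtype.ext (eq_univ_of_forall fun q => latticeSpec.top_notMem q)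
  map_bot' := Subtype.ext (eq_empty_of_forall_notMem fun q => not_not.mpr (latticeSpec.bot_mem q))

lemma stoneHom_injective : Injective (stoneHom L) := by
  have hle {a b : L} (h : stoneHom L a = stoneHom L b) : a ≤ b := by
    by_contra hab
    obtain ⟨q, hbq, haq⟩ := latticeSpec.exists_mem_notMem_of_not_le hab
    have hsub : (stoneHom L a).1 ⊆ (stoneHom L b).1 := h.le
    exact hsub haq hbq
  exact fun a b h => (hle h).antisymm (hle h.symm)

lemma stoneHom_surjective : Surjective (stoneHom L) :=
  generatesLattice_range_basicOpen (isAbstractSpectrum_latticeSpec L)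
    (Sublattice.LatticeHom.range (stoneHom L).toLatticeHom) ⟨⊥, map_bot (stoneHom L)⟩
    ⟨⊤, map_top (stoneHom L)⟩ subset_rfl

/-- Stone duality for distributive lattices, as an isomorphism of `L` with the lattice `ℒ⁺` of its
spectrum. -/
noncomputable def stoneIso : L ≃o (familyBitopology (latticeSpec L)).sublatticePlus :=
  RelIso.ofSurjective (orderEmbeddingOfInjective (stoneHom L) (stoneHom_injective L))
    (stoneHom_surjective L)

end Stone

section SpecLift

variable {X L : Type*} {S : Set (Set X)} [DistribLattice L] [BoundedOrder L] {θ : X → L}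
  {hθ : ∀ q ∈ latticeSpec L, θ ⁻¹' q ∈ S}

/-- The homomorphism `ℒ⁺(S) → L` dual to the morphism `q ↦ θ⁻¹(q)` from `spec(L)` to `S`. -/
noncomputable def specLift
    (h : IsSMorphism (familyBitopology (latticeSpec L)) (familyBitopology S)
      (specPreimage S θ hθ)) :
    BoundedLatticeHom (familyBitopology S).sublatticePlus L :=
  BoundedLatticeHom.comp (stoneIso L).symm h.preimageHom

lemma specLift_comp_basicOpen
    (h : IsSMorphism (familyBitopology (latticeSpec L)) (familyBitopology S)
      (specPreimage S θ hθ)) :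
    specLift h ∘ basicOpen S = θ :=
  funext fun x => (stoneIso L).symm_apply_eq.mpr
    (rfl : h.preimageHom (basicOpen S x) = stoneIso L (θ x))

lemma specLift_bijective
    (h : IsSIsomorphism (familyBitopology (latticeSpec L)) (familyBitopology S)
      (specPreimage S θ hθ)) :
    Bijective (specLift h.1) :=
  (stoneIso L).symm.bijective.comp h.preimageHom_bijective

theorem existsUnique_boundedLatticeHom_comp_basicOpen
    (h : IsSMorphism (familyBitopology (latticeSpec L)) (familyBitopology S)
      (specPreimage S θ hθ)) :
    ∃! l : BoundedLatticeHom (familyBitopology S).sublatticePlus L, l ∘ basicOpen S = θ :=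
  ⟨specLift h, specLift_comp_basicOpen h, fun _ hl =>
    (generatesLattice_range_basicOpen h.target).eq_of_comp_eq
      (hl.trans (specLift_comp_basicOpen h).symm)⟩

theorem existsUnique_orderIso_comp_basicOpen
    (h : IsSIsomorphism (familyBitopology (latticeSpec L)) (familyBitopology S)
      (specPreimage S θ hθ)) :
    ∃! l : (familyBitopology S).sublatticePlus ≃o L, l ∘ basicOpen S = θ :=
  ⟨RelIso.ofSurjective
      (orderEmbeddingOfInjective (specLift h.1) (specLift_bijective h).injective)
      (specLift_bijective h).surjective,
    specLift_comp_basicOpen h.1,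
    fun _ hl => (generatesLattice_range_basicOpen h.1.target).eq_of_comp_eq
      (hl.trans (specLift_comp_basicOpen h.1).symm)⟩

end SpecLift

theorem corollary2p4p2_general {X : Type u} (oplus otimes : X → X → Set X) (S : Set (Set X))
    (hS : (familyBitopology S).IsAbstractSpectrum) (hprime : S ⊆ primeIdeals oplus otimes) :
    ∃ (L : Type u) (_ : DistribLattice L) (_ : BoundedOrder L) (φ : X → L),
      GeneratesLattice (Set.range φ) ∧
      (∃ h : ∀ q ∈ latticeSpec L, φ ⁻¹' q ∈ S,
        BitopologicalSpace.IsSIsomorphism (familyBitopology (latticeSpec L)) (familyBitopology S)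
          (specPreimage S φ h)) ∧
      (∀ (L' : Type v) [DistribLattice L'] [BoundedOrder L'] (θ : X → L')
        (hθ : ∀ q ∈ latticeSpec L', θ ⁻¹' q ∈ S),
        BitopologicalSpace.IsSMorphism (familyBitopology (latticeSpec L')) (familyBitopology S)
          (specPreimage S θ hθ) →
        ∃! l : BoundedLatticeHom L L', ⇑l ∘ φ = θ) ∧
      (∀ (L₁ : Type v) [DistribLattice L₁] [BoundedOrder L₁] (φ₁ : X → L₁)
        (hφ₁ : ∀ q ∈ latticeSpec L₁, φ₁ ⁻¹' q ∈ S),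
        BitopologicalSpace.IsSIsomorphism (familyBitopology (latticeSpec L₁)) (familyBitopology S)
          (specPreimage S φ₁ hφ₁) →
        ∃! l : L ≃o L₁, ⇑l ∘ φ = φ₁) ∧
      (∀ a b : X, oplus a b ⊆ {x | φ x ≤ φ a ⊔ φ b}) ∧
      (∀ a b : X, otimes a b ⊆ {x | φ a ⊓ φ b ≤ φ x}) :=
  ⟨(familyBitopology S).sublatticePlus, inferInstance, inferInstance, basicOpen S,
    generatesLattice_range_basicOpen hS,
    ⟨preimage_basicOpen_mem hS, isSIsomorphism_specPreimage_basicOpen hS⟩,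
    fun _ _ _ _ _ h => existsUnique_boundedLatticeHom_comp_basicOpen h,
    fun _ _ _ _ _ h => existsUnique_orderIso_comp_basicOpen h,
    fun a b _ hx => basicOpen_le_sup_iff.mpr fun _ hp ha hb =>
      (hprime hp).oplus_subset a b ha hb hx,
    fun a b x hx => inf_le_basicOpen_iff.mpr fun _ hp hxp =>
      (hprime hp).mem_or_mem a b ⟨x, hx, hxp⟩⟩

theorem corollary2p4p2 {X : Type u} (oplus otimes : X → X → Set X) (ξ₀ ξ₁ : X)
    (hξ : ξ₀ ≠ ξ₁) (S : Set (Set X))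
    (hS : S = properPrimeIdeals oplus otimes ξ₀ ξ₁ ∨ S = primeIdeals oplus otimes) :
    ∃ (L : Type u) (_ : DistribLattice L) (_ : BoundedOrder L) (φ : X → L),
      GeneratesLattice (Set.range φ) ∧
      (∃ h : ∀ q ∈ latticeSpec L, φ ⁻¹' q ∈ S,
        BitopologicalSpace.IsSIsomorphism (familyBitopology (latticeSpec L)) (familyBitopology S)
          (specPreimage S φ h)) ∧
      (∀ (L' : Type v) [DistribLattice L'] [BoundedOrder L'] (θ : X → L')
        (hθ : ∀ q ∈ latticeSpec L', θ ⁻¹' q ∈ S),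
        BitopologicalSpace.IsSMorphism (familyBitopology (latticeSpec L')) (familyBitopology S)
          (specPreimage S θ hθ) →
        ∃! l : BoundedLatticeHom L L', ⇑l ∘ φ = θ) ∧
      (∀ (L₁ : Type v) [DistribLattice L₁] [BoundedOrder L₁] (φ₁ : X → L₁)
        (hφ₁ : ∀ q ∈ latticeSpec L₁, φ₁ ⁻¹' q ∈ S),
        BitopologicalSpace.IsSIsomorphism (familyBitopology (latticeSpec L₁)) (familyBitopology S)
          (specPreimage S φ₁ hφ₁) →
        ∃! l : L ≃o L₁, ⇑l ∘ φ = φ₁) ∧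
      (∀ a b : X, oplus a b ⊆ {x | φ x ≤ φ a ⊔ φ b}) ∧
      (∀ a b : X, otimes a b ⊆ {x | φ a ⊓ φ b ≤ φ x}) := by
  obtain rfl | rfl := hS
  · exact corollary2p4p2_general oplus otimes _
      (isAbstractSpectrum_properPrimeIdeals oplus otimes ξ₀ ξ₁) fun _ hp => hp.1
  · exact corollary2p4p2_general oplus otimes _
      (isAbstractSpectrum_primeIdeals oplus otimes) subset_rfl
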